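/- A digraph $D=(V,A)$ has a finite vertex set $V$ and a finite set $A$ of arcs, each arc having an origin and a target in $V$ (loops and multiple arcs are allowed). A mixed graph is a digraph $D=(V,A)$ together with a partition $E$ of $A$ into singletons (oriented edges) and doubletons consisting of two opposite arcs (unoriented edges). Let $c(D)$ be the number of connected components of the underlying graph, and for $S\subseteq A$ let $D_{\setminus S}$ be the digraph obtained by deleting the arcs in $S$; a digraph is acyclic if it has no directed cycle (a loop is a directed cycle). Let $B_D(q,y,z)$ be the unique polynomial such that for every positive integer $q$, $$B_D(q,y,z)=\sum_{f:V\to\{1,\dots,q\}} y^{\#\{(u,v)\in A:\ f(u)<f(v)\}}\,z^{\#\{(u,v)\in A:\ f(u)>f(v)\}},$$ and let $$T^{(1)}_D(x,y)=\frac{y^{|E|}}{(y-1)^{|V|}(x-1)^{c(D)}}\,B_D\!\left((x-1)(y-1),\tfrac1y,1\right).$$ Theorem. For every mixed graph $D$, the rational function $T^{(1)}_D(x,y)$ is a polynomial in $x$ and $y$ with rational coefficients, and $$(y+1)^{|E|+c(D)-|V|}\;T^{(1)}_D\!\left(y+2,\frac{y}{y+1}\right)=\sum_{\substack{S\subseteq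 A\\ D_{\setminus S}\text{ acyclic}}} y^{|E|-|A\setminus S|},$$ both as an identity in the field $\mathbb{Q}(y)$ of rational functions and for every $y\neq -1$ in a field of characteristic zero (including $y=0$). -/

import Mathlib

/-- A directed multigraph: `V` is the set of vertices, `A` the set of arcs,
and every arc has an origin and a target. Loops and multiple arcs are allowed. -/
structure MultiDigraph (V A : Type*) where
  origin : A → V
  target : A → V

namespace MultiDigraph

variable {V A : Type*}

/-- The arcs `a` and `b` are opposite: `a = (u, v)` and `b = (v, u)`. -/
def IsOpposite (D : MultiDigraph V A) (a b : A) : Prop :=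
  D.origin a = D.target b ∧ D.target a = D.origin b

/-- There is an arc from `u` to `v`. -/
def HasArc (D : MultiDigraph V A) (u v : V) : Prop :=
  ∃ a, D.origin a = u ∧ D.target a = v

/-- `D` has no directed cycle: there is no directed walk of positive length from a vertex to
itself. (A loop is a directed cycle.) -/
def IsAcyclic (D : MultiDigraph V A) : Prop :=
  ∀ v, ¬ Relation.TransGen D.HasArc v v

/-- The digraph `D ∖ S` obtained by deleting the arcs in `S`. -/
def delete (D : MultiDigraph V A) (S : Finset A) : MultiDigraph V {a : A // a ∉ S} where
  origin a := D.origin a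
  target a := D.target a

/-- The number of connected components of the graph underlying `D`. -/
noncomputable def numComponents (D : MultiDigraph V A) : ℕ :=
  Nat.card (SimpleGraph.fromRel D.HasArc).ConnectedComponent

/-- The number of ascents of the coloring `f`, i.e. of arcs `(u, v)` with `f u < f v`. -/
def numAscents [Fintype A] (D : MultiDigraph V A) {q : ℕ} (f : V → Fin q) : ℕ :=
  (Finset.univ.filter fun a => f (D.origin a) < f (D.target a)).card

/-- The number of descents of the coloring `f`, i.e. of arcs `(u, v)` with `f u > f v`. -/
def numDescents [Fintype A] (D : MultiDigraph V A) {q : ℕ} (f : V → Fin q) : ℕ :=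
  (Finset.univ.filter fun a => f (D.target a) < f (D.origin a)).card

open MvPolynomial in
open scoped Classical in
/-- `B(q, y, z)` is a trivariate polynomial such that for every positive integer `q`, as
polynomials in `y, z`,
`B(q, y, z) = ∑_{f : V → [q]} y ^ (number of ascents of f) * z ^ (number of descents of f)`. -/
def IsBPolynomial [Fintype V] [Fintype A] (D : MultiDigraph V A)
    (B : MvPolynomial (Fin 3) ℚ) : Prop :=
  ∀ q : ℕ, 0 < q →
    aeval (![(q : MvPolynomial (Fin 2) ℚ), X 0, X 1]) B =
      ∑ f : V → Fin q, X 0 ^ D.numAscents f * X 1 ^ D.numDescents f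

open scoped Classical in
theorem sum_colorings [Fintype V] [Fintype A] {R : Type*} [CommRing R]
    (D : MultiDigraph V A) (q : ℕ) (y z : R) :
    ∑ f : V → Fin q, y ^ D.numAscents f * z ^ D.numDescents f =
      ∑ p ∈ Finset.range (Fintype.card V + 1), q.choose p •
        ∑ g : V → Fin p with Function.Surjective g,
          y ^ D.numAscents g * z ^ D.numDescents g := by
  set h : ℕ → R := fun p => ∑ g : V → Fin p with Function.Surjective g,
    y ^ D.numAscents g * z ^ D.numDescents g with hh
  have key : ∀ S : Finset (Fin q),
      ∑ f : V → Fin q with Finset.univ.image f = S, y ^ D.numAscents f * z ^ D.numDescents f =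
        h S.card := by
    intro S
    symm
    have hmono := (S.orderEmbOfFin rfl).strictMono
    refine Finset.sum_bij (fun g _ v => S.orderEmbOfFin rfl (g v)) ?_ ?_ ?_ ?_
    · intro g hg
      simp only [Finset.mem_filter, Finset.mem_univ, true_and] at hg ⊢
      ext s
      simp only [Finset.mem_image, Finset.mem_univ, true_and]
      constructor
      · rintro ⟨v, rfl⟩
        exact S.orderEmbOfFin_mem rfl _
      · intro hs
        have : s ∈ Set.range (S.orderEmbOfFin rfl) := by
          rw [Finset.range_orderEmbOfFin]; exact hs
        obtain ⟨i, rfl⟩ := this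
        obtain ⟨v, rfl⟩ := hg i
        exact ⟨v, rfl⟩
    · intro g₁ _ g₂ _ he
      funext v
      exact (S.orderEmbOfFin rfl).injective (congrFun he v)
    · intro f hf
      simp only [Finset.mem_filter, Finset.mem_univ, true_and] at hf
      have hr : ∀ v, ∃ i, S.orderEmbOfFin rfl i = f v := by
        intro v
        have : f v ∈ Set.range (S.orderEmbOfFin rfl) := by
          rw [Finset.range_orderEmbOfFin, ← hf]; simp
        exact this
      choose g hg using hr
      refine ⟨g, ?_, funext hg⟩
      simp only [Finset.mem_filter, Finset.mem_univ, true_and]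
      intro i
      have hi : S.orderEmbOfFin rfl i ∈ Finset.univ.image f := by
        rw [hf]; exact S.orderEmbOfFin_mem rfl i
      simp only [Finset.mem_image, Finset.mem_univ, true_and] at hi
      obtain ⟨v, hv⟩ := hi
      exact ⟨v, (S.orderEmbOfFin rfl).injective ((hg v).trans hv)⟩
    · intro g _
      have ha : D.numAscents (fun v => S.orderEmbOfFin rfl (g v)) = D.numAscents g := by
        simp [numAscents]
      have hd : D.numDescents (fun v => S.orderEmbOfFin rfl (g v)) = D.numDescents g := by
        simp [numDescents]
      rw [ha, hd]
  have h0 : ∀ p, Fintype.card V < p → h p = 0 := by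
    intro p hp
    refine Finset.sum_eq_zero fun g hg => ?_
    simp only [Finset.mem_filter, Finset.mem_univ, true_and] at hg
    have := Fintype.card_le_of_surjective g hg
    simp at this
    omega
  have e1 : ∑ f : V → Fin q, y ^ D.numAscents f * z ^ D.numDescents f =
      ∑ S : Finset (Fin q), h S.card := by
    rw [← Finset.sum_fiberwise (Finset.univ) (fun f : V → Fin q => Finset.univ.image f)]
    exact Finset.sum_congr rfl fun S _ => key S
  rw [e1, ← Finset.powerset_univ, Finset.sum_powerset_apply_card]
  simp only [Finset.card_univ, Fintype.card_fin]
  have e2 : ∀ a b : ℕ, (∀ p, b ≤ p → q.choose p • h p = 0) → b ≤ a →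
      ∑ p ∈ Finset.range a, q.choose p • h p = ∑ p ∈ Finset.range b, q.choose p • h p := by
    intro a b hb hab
    symm
    refine Finset.sum_subset (by simpa using hab) fun p _ hp => hb p (by simpa using hp)
  have hq : ∀ p, q + 1 ≤ p → q.choose p • h p = 0 := fun p hp => by
    rw [Nat.choose_eq_zero_of_lt (by omega), zero_smul]
  have hV : ∀ p, Fintype.card V + 1 ≤ p → q.choose p • h p = 0 := fun p hp => by
    rw [h0 p (by omega), smul_zero]
  rcases le_total (q + 1) (Fintype.card V + 1) with hle | hle
  · exact (e2 _ _ hq hle).symm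
  · exact e2 _ _ hV hle

open MvPolynomial in
open scoped Classical in
theorem exists_isBPolynomial [Fintype V] [Fintype A] (D : MultiDigraph V A) :
    ∃ B, D.IsBPolynomial B := by
  refine ⟨∑ p ∈ Finset.range (Fintype.card V + 1),
    C ((p.factorial : ℚ)⁻¹) * Polynomial.aeval (X 0) (descPochhammer ℚ p) *
      ∑ g : V → Fin p with Function.Surjective g,
        X 1 ^ D.numAscents g * X 2 ^ D.numDescents g, fun q _ => ?_⟩
  rw [sum_colorings, map_sum]
  refine Finset.sum_congr rfl fun p _ => ?_
  have hc : aeval ![(q : MvPolynomial (Fin 2) ℚ), X 0, X 1]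
      (Polynomial.aeval (X 0 : MvPolynomial (Fin 3) ℚ) (descPochhammer ℚ p)) =
      C ((q.descFactorial p : ℚ)) := by
    rw [← Polynomial.aeval_algHom_apply, aeval_X]
    have : (![(q : MvPolynomial (Fin 2) ℚ), X 0, X 1] 0) =
        algebraMap ℚ (MvPolynomial (Fin 2) ℚ) (q : ℚ) := by simp
    rw [this, Polynomial.aeval_algebraMap_apply, Polynomial.coe_aeval_eq_eval,
      descPochhammer_eval_eq_descFactorial]
    rfl
  rw [map_mul, map_mul, hc, aeval_C, MvPolynomial.algebraMap_eq, ← C_mul, nsmul_eq_mul]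
  have hn : (p.factorial : ℚ)⁻¹ * (q.descFactorial p : ℚ) = (q.choose p : ℚ) := by
    rw [Nat.descFactorial_eq_factorial_mul_choose]
    have : (p.factorial : ℚ) ≠ 0 := by exact_mod_cast p.factorial_ne_zero
    push_cast
    field_simp
  rw [hn]
  simp

theorem IsBPolynomial.unique [Fintype V] [Fintype A] {D : MultiDigraph V A}
    {B B' : MvPolynomial (Fin 3) ℚ} (h : D.IsBPolynomial B) (h' : D.IsBPolynomial B') :
    B = B' := by
  refine MvPolynomial.funext_set
    (fun i => if i = 0 then Set.range (fun n : ℕ => ((n : ℚ) + 1)) else Set.univ) ?_ ?_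
  · intro i
    split_ifs
    · exact Set.infinite_range_of_injective fun a b hab => by simpa using hab
    · exact Set.infinite_univ
  · intro x hx
    obtain ⟨n, hn⟩ : x 0 ∈ Set.range (fun n : ℕ => ((n : ℚ) + 1)) := by
      simpa using hx 0 (Set.mem_univ _)
    have e : ∀ P : MvPolynomial (Fin 3) ℚ, MvPolynomial.eval x P =
        MvPolynomial.aeval ![x 1, x 2] (MvPolynomial.aeval
          ![((n + 1 : ℕ) : MvPolynomial (Fin 2) ℚ), MvPolynomial.X 0, MvPolynomial.X 1] P) := by
      intro P
      rw [← AlgHom.comp_apply, MvPolynomial.comp_aeval, ← MvPolynomial.coe_aeval_eq_eval]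
      have hx' : x = fun i => MvPolynomial.aeval ![x 1, x 2]
          (![((n + 1 : ℕ) : MvPolynomial (Fin 2) ℚ), MvPolynomial.X 0, MvPolynomial.X 1] i) := by
        funext i
        fin_cases i <;> simp [← hn]
      exact congrArg (fun t => MvPolynomial.aeval t P) hx'
    rw [e, e, h _ n.succ_pos, h' _ n.succ_pos]

/-- The `B`-polynomial `B_D(q, y, z)`: the unique polynomial with `IsBPolynomial`. -/
noncomputable def bPolynomial [Fintype V] [Fintype A] (D : MultiDigraph V A) :
    MvPolynomial (Fin 3) ℚ :=
  D.exists_isBPolynomial.choose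

open scoped Classical in
/-- The arc sets `S` such that `D ∖ S` is acyclic. -/
noncomputable def acyclicDeletions [Fintype A] (D : MultiDigraph V A) : Finset (Finset A) :=
  Finset.univ.filter fun S => (D.delete S).IsAcyclic

end MultiDigraph

/-- A mixed graph: a digraph with a partition of its arc set into singletons (the oriented edges)
and doubletons made of two opposite arcs (the unoriented edges). -/
structure MixedGraph (V A : Type*) [Fintype A] [DecidableEq A] extends MultiDigraph V A where
  edges : Finpartition (Finset.univ : Finset A)
  edges_spec : ∀ e ∈ edges.parts,
    (∃ a, e = {a}) ∨ ∃ a b, a ≠ b ∧ toMultiDigraph.IsOpposite a b ∧ e = {a, b}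

namespace MixedGraph

variable {V A : Type*} [Fintype V] [Fintype A] [DecidableEq A]

/-- The number `|E(D)|` of edges (oriented or not) of a mixed graph. -/
def numEdges (D : MixedGraph V A) : ℕ := D.edges.parts.card

/-- The invariant
`T⁽¹⁾_D(x, y) = y ^ |E(D)| / ((y - 1) ^ |V| (x - 1) ^ c(D)) * B_D((x - 1)(y - 1), 1 / y, 1)`,
as a rational function in `x` (variable `0`) and `y` (variable `1`). -/
noncomputable def tutteOne (D : MixedGraph V A) : FractionRing (MvPolynomial (Fin 2) ℚ) :=
  let x := algebraMap (MvPolynomial (Fin 2) ℚ) (FractionRing (MvPolynomial (Fin 2) ℚ))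
    (MvPolynomial.X 0)
  let y := algebraMap (MvPolynomial (Fin 2) ℚ) (FractionRing (MvPolynomial (Fin 2) ℚ))
    (MvPolynomial.X 1)
  y ^ D.numEdges / ((y - 1) ^ Fintype.card V * (x - 1) ^ D.numComponents) *
    MvPolynomial.aeval ![(x - 1) * (y - 1), 1 / y, 1] D.bPolynomial

end MixedGraph

/-! Everything is expanded over sets `S` of edges. An unoriented edge carries two opposite arcs, so
each edge has at most one ascent under a coloring `f`, and `|E|` minus the number of ascents counts
the edges without ascent. Writing `y = (y - 1) + 1` on each such edge gives `y^|E| B(q, 1/y, 1) =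
∑_S (y - 1)^|S| W_S(q)`, where `W_S` is the weak order polynomial of the arcs in `S`
(`pow_numEdges_mul_aeval_bPolynomial`).

Polynomiality: `W_S` is divisible by `q^k`, with `k` the number of components of `(V, S)`. Since `k
≥ |V| - |S|` and `k ≥ c(D)`, putting `q = (x - 1)(y - 1)` makes every summand divisible by `(y -
1)^|V| (x - 1)^c(D)` (`exists_mul_eq_sum_weakOrderPoly`).

Evaluation: the substitution `x = y + 2`, `y ↦ y/(y + 1)` sends `q` to `-1`. For each surjective
coloring, the sum over edge sets without ascent equals a sum over sets of ascending arcs, that is,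
over arc sets along which the coloring is strict. At `q = -1` the strict order polynomial of an
acyclic relation equals `(-1)^|V|`, so each acyclic arc set contributes one power of `y`
(`sum_acyclicDeletions_pow`). -/

/-! ### Strict order polynomials at `-1`. -/

open scoped Classical in
/-- The number of surjections `g : V → Fin p` that are strictly increasing along `r`. -/
noncomputable def numStrictSurjections {V : Type*} [Fintype V] (r : V → V → Prop) (p : ℕ) : ℕ :=
  (Finset.univ.filter fun g : V → Fin p =>
    Function.Surjective g ∧ ∀ u v, r u v → g u < g v).card

section StrictSurjections

variable {V : Type*} [Fintype V]

theorem numStrictSurjections_zero [Nonempty V] (r : V → V → Prop) :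
    numStrictSurjections r 0 = 0 := by
  classical
  simp only [numStrictSurjections, Finset.card_eq_zero]
  refine Finset.filter_eq_empty_iff.2 fun g _ => ?_
  exact (g (Classical.arbitrary V)).elim0

theorem numStrictSurjections_of_isEmpty [IsEmpty V] (r : V → V → Prop) (p : ℕ) :
    numStrictSurjections r p = if p = 0 then 1 else 0 := by
  classical
  unfold numStrictSurjections
  split_ifs with h
  · subst h
    rw [Finset.filter_true_of_mem]
    · simp
    · exact fun g _ => ⟨fun i => i.elim0, fun u => isEmptyElim u⟩
  · rw [Finset.card_eq_zero]
    refine Finset.filter_eq_empty_iff.2 fun g _ hg => ?_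
    obtain ⟨v, -⟩ := hg.1 ⟨0, Nat.pos_of_ne_zero h⟩
    exact isEmptyElim v

/-- The strictly increasing surjections onto `Fin (p + 1)` whose fiber over `0` is a given nonempty
set `I` of minimal elements correspond to those from the complement of `I` onto `Fin p`. -/
theorem card_strictSurjections_fiber_zero [DecidableEq V] (r : V → V → Prop) (p : ℕ) (I : Finset V)
    (hI : I.Nonempty) (hmin : ∀ v ∈ I, ∀ u, ¬ r u v)
    [DecidablePred fun g : V → Fin (p + 1) =>
      (Function.Surjective g ∧ ∀ u v, r u v → g u < g v) ∧ Finset.univ.filter (g · = 0) = I] :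
    (Finset.univ.filter fun g : V → Fin (p + 1) =>
      (Function.Surjective g ∧ ∀ u v, r u v → g u < g v) ∧
        Finset.univ.filter (g · = 0) = I).card =
      numStrictSurjections (fun u v : {v // v ∉ I} => r u v) p := by
  classical
  symm
  refine Finset.card_bij (fun g _ v => if h : v ∈ I then 0 else (g ⟨v, h⟩).succ) ?_ ?_ ?_
  · intro g hg
    simp only [Finset.mem_filter, Finset.mem_univ, true_and] at hg ⊢
    refine ⟨⟨?_, ?_⟩, ?_⟩
    · intro i
      refine Fin.cases ?_ (fun j => ?_) i
      · obtain ⟨v, hv⟩ := hI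
        exact ⟨v, by simp [hv]⟩
      · obtain ⟨⟨v, hv⟩, rfl⟩ := hg.1 j
        exact ⟨v, by simp [hv]⟩
    · intro u v huv
      have hv : v ∉ I := fun hv => hmin v hv u huv
      by_cases hu : u ∈ I
      · simp [hu, hv, Fin.succ_pos]
      · simpa [hu, hv] using hg.2 ⟨u, hu⟩ ⟨v, hv⟩ huv
    · ext v
      by_cases hv : v ∈ I <;> simp [hv, Fin.succ_ne_zero]
  · intro g _ g' _ h
    funext ⟨v, hv⟩
    simpa [hv] using congrFun h v
  · intro g hg
    simp only [Finset.mem_filter, Finset.mem_univ, true_and] at hg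
    obtain ⟨⟨hs, hr⟩, hz⟩ := hg
    have hz' : ∀ v, v ∈ I ↔ g v = 0 := fun v => by rw [← hz]; simp
    refine ⟨fun v => (g v).pred fun h => v.2 ((hz' _).2 h), ?_, ?_⟩
    · simp only [Finset.mem_filter, Finset.mem_univ, true_and]
      refine ⟨fun j => ?_, fun u v huv => ?_⟩
      · obtain ⟨v, hv⟩ := hs j.succ
        refine ⟨⟨v, fun h => ?_⟩, ?_⟩
        · rw [hz', hv] at h
          exact Fin.succ_ne_zero _ h
        · simp [hv]
      · simpa using hr u v huv
    · funext v
      by_cases hv : v ∈ I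
      · simp [hv, (hz' v).1 hv]
      · simp [hv]

-- A vertex sent to `0` can have no predecessor, because nothing lies below `0`; hence the fiber
-- over `0` is a nonempty set of minimal vertices.
open scoped Classical in
theorem numStrictSurjections_succ (r : V → V → Prop) (p : ℕ) :
    numStrictSurjections r (p + 1) =
      ∑ I ∈ (Finset.univ.filter fun v => ∀ u, ¬ r u v).powerset.erase ∅,
        numStrictSurjections (fun u v : {v // v ∉ I} => r u v) p := by
  rw [numStrictSurjections, Finset.card_eq_sum_card_fiberwise
    (f := fun g : V → Fin (p + 1) => Finset.univ.filter (g · = 0))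
    (t := (Finset.univ.filter fun v => ∀ u, ¬ r u v).powerset.erase ∅)]
  · refine Finset.sum_congr rfl fun I hI => ?_
    rw [Finset.mem_erase, Finset.mem_powerset] at hI
    rw [Finset.filter_filter]
    exact card_strictSurjections_fiber_zero r p I (Finset.nonempty_iff_ne_empty.2 hI.1)
      fun v hv => (Finset.mem_filter.1 (hI.2 hv)).2
  · intro g hg
    simp only [Finset.coe_filter, Finset.mem_univ, true_and, Set.mem_ofPred_eq] at hg
    simp only [Finset.coe_erase, Set.mem_sdiff, Finset.mem_coe, Finset.mem_powerset,
      Set.mem_singleton_iff]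
    refine ⟨fun v hv => ?_, ?_⟩
    · simp only [Finset.mem_filter, Finset.mem_univ, true_and] at hv ⊢
      intro u hu
      have := hg.2 u v hu
      rw [hv] at this
      exact absurd this (Fin.not_lt_zero _)
    · obtain ⟨v, hv⟩ := hg.1 0
      exact (Finset.nonempty_iff_ne_empty.1 ⟨v, by simpa using hv⟩)

theorem exists_minimal_of_acyclic [Nonempty V] (r : V → V → Prop)
    (hr : ∀ v, ¬ Relation.TransGen r v v) : ∃ v, ∀ u, ¬ r u v := by
  have : Std.Irrefl (Relation.TransGen r) := ⟨hr⟩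
  have wf : WellFounded (Relation.TransGen r) := Finite.wellFounded_of_trans_of_irrefl _
  obtain ⟨v, -, hv⟩ := wf.has_min Set.univ Set.univ_nonempty
  exact ⟨v, fun u h => hv u trivial (.single h)⟩

end StrictSurjections

/-- The value at `-1` of the strict order polynomial of an acyclic relation. -/
theorem sum_neg_one_pow_mul_numStrictSurjections {V : Type*} [Fintype V] (r : V → V → Prop)
    (hr : ∀ v, ¬ Relation.TransGen r v v) (N : ℕ) (hN : Fintype.card V < N) :
    ∑ p ∈ Finset.range N, (-1 : ℤ) ^ p * numStrictSurjections r p = (-1) ^ Fintype.card V := by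
  classical
  induction hn : Fintype.card V using Nat.strong_induction_on generalizing V N with
  | _ n ih =>
  -- The range length is kept free: the recursion lowers it by one and removes at least one vertex,
  -- so `|V| < N` persists.
  obtain ⟨N, rfl⟩ : ∃ M, N = M + 1 := ⟨N - 1, by omega⟩
  rcases isEmpty_or_nonempty V with hV | hV
  · have : n = 0 := by rw [← hn]; simp
    subst this
    simp [numStrictSurjections_of_isEmpty]
  set M : Finset V := Finset.univ.filter fun v => ∀ u, ¬ r u v with hM
  have hMne : M.Nonempty := by
    obtain ⟨v, hv⟩ := exists_minimal_of_acyclic r hr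
    exact ⟨v, by simpa [hM] using hv⟩
  have key : ∀ I ∈ M.powerset.erase ∅, ∑ p ∈ Finset.range N, (-1 : ℤ) ^ p *
      numStrictSurjections (fun u v : {v // v ∉ I} => r u v) p = (-1) ^ n * (-1) ^ I.card := by
    intro I hI
    have hI' : 0 < I.card := Finset.card_pos.2 (Finset.nonempty_iff_ne_empty.2
      (Finset.mem_erase.1 hI).1)
    have hle : I.card ≤ n := hn ▸ Finset.card_le_univ I
    have hc : Fintype.card {v // v ∉ I} = n - I.card := by
      rw [Fintype.card_subtype_compl, hn]; simp
    rw [ih (n - I.card) (by omega) _ _ N (by omega) hc]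
    · obtain ⟨k, rfl⟩ := Nat.exists_eq_add_of_le hle
      rw [Nat.add_sub_cancel_left, pow_add, mul_comm, ← mul_assoc, ← pow_add, ← two_mul,
        pow_mul]
      simp
    · intro v hv
      exact hr v (hv.lift Subtype.val fun _ _ h => h)
  -- The nonempty subsets of `M` have alternating sum `-1`, which cancels the sign produced by the
  -- shift `p ↦ p + 1`.
  have hsum := Finset.sum_powerset_neg_one_pow_card_of_nonempty hMne
  rw [← Finset.add_sum_erase _ _ (Finset.empty_mem_powerset M)] at hsum
  rw [Finset.sum_range_succ', numStrictSurjections_zero]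
  simp only [numStrictSurjections_succ, Nat.cast_zero, mul_zero, add_zero, Nat.cast_sum,
    Finset.mul_sum]
  rw [Finset.sum_comm]
  simp only [pow_succ, mul_neg_one, neg_mul, Finset.sum_neg_distrib]
  rw [Finset.sum_congr rfl key, ← Finset.mul_sum]
  simp only [Finset.card_empty, pow_zero] at hsum
  linear_combination (-(-1) ^ n) * hsum

/-! ### Counting components. -/

/-- The number of components is the dimension of the kernel of the Laplacian. That kernel contains
the solutions of the `|ι|` equations `x (s i) = x (t i)`, a space of dimension at least `|V| - |ι|`.
-/
theorem SimpleGraph.card_vert_le_card_add_card_connectedComponent {V ι : Type*} [Fintype V]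
    [Fintype ι] (G : SimpleGraph V) (s t : ι → V)
    (h : ∀ u v, G.Adj u v → ∃ i, s i = u ∧ t i = v ∨ s i = v ∧ t i = u) :
    Fintype.card V ≤ Fintype.card ι + Nat.card G.ConnectedComponent := by
  classical
  let φ : (V → ℝ) →ₗ[ℝ] (ι → ℝ) := LinearMap.funLeft ℝ ℝ s - LinearMap.funLeft ℝ ℝ t
  have hφ : φ.ker ≤ (G.lapMatrix ℝ).toLin'.ker := by
    intro x hx
    rw [LinearMap.mem_ker, Matrix.toLin'_apply, G.lapMatrix_mulVec_eq_zero_iff_forall_adj]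
    intro u v huv
    rw [LinearMap.mem_ker] at hx
    have hx' : ∀ i, x (s i) = x (t i) := fun i => by
      simpa [φ, LinearMap.funLeft_apply, sub_eq_zero] using congrFun hx i
    obtain ⟨i, ⟨rfl, rfl⟩ | ⟨rfl, rfl⟩⟩ := h u v huv
    · exact hx' i
    · exact (hx' i).symm
  have h1 := φ.finrank_range_add_finrank_ker
  have h2 := Submodule.finrank_mono hφ
  have h3 := Submodule.finrank_le φ.range
  rw [← G.card_connectedComponent_eq_finrank_ker_toLin'_lapMatrix, ← Nat.card_eq_fintype_card]
    at h2
  simp only [Module.finrank_fintype_fun_eq_card] at h1 h3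
  omega

/-! ### Weak order polynomials and their divisibility by powers of `X`. -/

open Polynomial

/-- The binomial coefficient `X choose p` as a polynomial. -/
noncomputable def binomialPoly (p : ℕ) : ℚ[X] := C ((p.factorial : ℚ)⁻¹) * descPochhammer ℚ p

theorem binomialPoly_eval_natCast (p q : ℕ) : (binomialPoly p).eval (q : ℚ) = q.choose p := by
  rw [binomialPoly, eval_mul, eval_C, descPochhammer_eval_eq_descFactorial,
    Nat.descFactorial_eq_factorial_mul_choose]
  have : (p.factorial : ℚ) ≠ 0 := by exact_mod_cast p.factorial_ne_zero
  push_cast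
  field_simp

theorem binomialPoly_eval_neg_one (p : ℕ) : (binomialPoly p).eval (-1) = (-1) ^ p := by
  have h : (descPochhammer ℚ p).eval (-1) = (-1) ^ p * p.factorial := by
    induction p with
    | zero => simp
    | succ p ih =>
      rw [descPochhammer_succ_eval, ih, Nat.factorial_succ]
      push_cast
      ring
  have : (p.factorial : ℚ) ≠ 0 := by exact_mod_cast p.factorial_ne_zero
  rw [binomialPoly, eval_mul, eval_C, h]
  field_simp

theorem Polynomial.eq_of_eval_natCast_eq {P Q : ℚ[X]}
    (h : ∀ q : ℕ, P.eval (q : ℚ) = Q.eval (q : ℚ)) :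
    P = Q :=
  eq_of_infinite_eval_eq P Q ((Set.infinite_range_of_injective Nat.cast_injective).mono
    (by rintro _ ⟨q, rfl⟩; exact h q))

open scoped Classical in
/-- The weak order polynomial of `r`: its value at `q` is the number of maps `f : V → Fin q` with
`f v ≤ f u` whenever `r u v`. -/
noncomputable def weakOrderPoly {V : Type*} [Fintype V] (r : V → V → Prop) : ℚ[X] :=
  ∑ p ∈ Finset.range (Fintype.card V + 1), binomialPoly p *
    ∑ g : V → Fin p with Function.Surjective g, if ∀ u v, r u v → g v ≤ g u then 1 else 0

section WeakOrderPoly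

variable {V : Type*} [Fintype V]

theorem weakOrderPoly_eval_natCast (r : V → V → Prop) (q : ℕ) :
    (weakOrderPoly r).eval (q : ℚ) =
      Nat.card {f : V → Fin q // ∀ u v, r u v → f v ≤ f u} := by
  classical
  -- One arc per related pair: with ascent weight `0` and descent weight `1`, and `0 ^ 0 = 1`, a
  -- coloring has weight `1` exactly when it is weak.
  let D : MultiDigraph V {e : V × V // r e.1 e.2} := ⟨fun e => e.1.1, fun e => e.1.2⟩
  have hD : ∀ (p : ℕ) (f : V → Fin p),
      (0 : ℚ) ^ D.numAscents f * 1 ^ D.numDescents f =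
        if ∀ u v, r u v → f v ≤ f u then 1 else 0 := by
    intro p f
    rw [one_pow, mul_one, zero_pow_eq]
    congr 1
    simp [MultiDigraph.numAscents, Finset.filter_eq_empty_iff, D]
  have h := D.sum_colorings q (0 : ℚ) 1
  simp only [hD] at h
  rw [Nat.card_eq_fintype_card, Fintype.card_subtype, ← Finset.sum_boole, h,
    weakOrderPoly, eval_finsetSum]
  refine Finset.sum_congr rfl fun p _ => ?_
  rw [eval_mul, binomialPoly_eval_natCast, nsmul_eq_mul, eval_finsetSum]
  congr 1
  refine Finset.sum_congr rfl fun g _ => ?_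
  split_ifs <;> simp

/-- A nonempty set has no map to `Fin 0`, so the constant term vanishes. -/
theorem X_dvd_weakOrderPoly [Nonempty V] (r : V → V → Prop) : X ∣ weakOrderPoly r := by
  classical
  have h := weakOrderPoly_eval_natCast r 0
  rw [Nat.cast_zero] at h
  rw [X_dvd_iff, coeff_zero_eq_eval_zero, h, Nat.cast_eq_zero, Nat.card_eq_zero]
  left
  exact ⟨fun f => (f.1 (Classical.arbitrary V)).elim0⟩

/-- No constraint links different blocks of `π`, so a weak map is an independent choice of one on
each block. -/
theorem weakOrderPoly_eq_prod {ι : Type*} [Fintype ι] [DecidableEq ι] (r : V → V → Prop)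
    (π : V → ι) (hπ : ∀ u v, r u v → π u = π v) :
    weakOrderPoly r = ∏ i, weakOrderPoly fun u v : {v // π v = i} => r u v := by
  classical
  refine eq_of_eval_natCast_eq fun q => ?_
  rw [eval_prod]
  simp only [weakOrderPoly_eval_natCast]
  rw [← Nat.cast_prod, ← Nat.card_pi, Nat.cast_inj]
  refine Nat.card_congr
    { toFun := fun f i => ⟨fun v => f.1 v, fun u v h => f.2 u v h⟩
      invFun := fun F => ⟨fun v => (F (π v)).1 ⟨v, rfl⟩, ?_⟩
      left_inv := fun f => rfl
      right_inv := fun F => ?_ }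
  · intro u v h
    have e : ∀ i (hi : π u = i), (F (π u)).1 ⟨u, rfl⟩ = (F i).1 ⟨u, hi⟩ := by
      rintro _ rfl; rfl
    beta_reduce
    rw [e _ (hπ u v h)]
    exact (F (π v)).2 ⟨u, hπ u v h⟩ ⟨v, rfl⟩ h
  · funext i
    ext ⟨v, rfl⟩
    rfl

theorem X_pow_card_connectedComponent_dvd_weakOrderPoly (r : V → V → Prop) :
    X ^ Nat.card (SimpleGraph.fromRel r).ConnectedComponent ∣ weakOrderPoly r := by
  classical
  let π := (SimpleGraph.fromRel r).connectedComponentMk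
  rw [weakOrderPoly_eq_prod r π, Nat.card_eq_fintype_card, Fintype.card, ← Finset.prod_const]
  · refine Finset.prod_dvd_prod_of_dvd _ _ fun i _ => ?_
    obtain ⟨v, hv⟩ := i.exists_rep
    have : Nonempty {v // π v = i} := ⟨⟨v, hv⟩⟩
    exact X_dvd_weakOrderPoly _
  · intro u v h
    by_cases huv : u = v
    · rw [huv]
    · exact SimpleGraph.ConnectedComponent.sound
        (SimpleGraph.Adj.reachable ((SimpleGraph.fromRel_adj r u v).2 ⟨huv, Or.inl h⟩))

end WeakOrderPoly
-- Uniqueness of `B` makes it explicit in the binomial basis, so `q` may be any element of a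
-- `ℚ`-algebra.
open scoped Classical in
theorem MultiDigraph.aeval_bPolynomial {V A R : Type*} [Fintype V] [Fintype A] [CommRing R]
    [Algebra ℚ R] (D : MultiDigraph V A) (q y z : R) :
    MvPolynomial.aeval ![q, y, z] D.bPolynomial =
      ∑ p ∈ Finset.range (Fintype.card V + 1), aeval q (binomialPoly p) *
        ∑ g : V → Fin p with Function.Surjective g,
          y ^ D.numAscents g * z ^ D.numDescents g := by
  set B : MvPolynomial (Fin 3) ℚ := ∑ p ∈ Finset.range (Fintype.card V + 1),
    aeval (MvPolynomial.X 0) (binomialPoly p) *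
      ∑ g : V → Fin p with Function.Surjective g,
        MvPolynomial.X 1 ^ D.numAscents g * MvPolynomial.X 2 ^ D.numDescents g with hB
  have h : D.IsBPolynomial B := by
    intro q _
    rw [D.sum_colorings]
    simp only [hB, map_sum, map_mul, map_pow, ← Polynomial.aeval_algHom_apply,
      MvPolynomial.aeval_X]
    refine Finset.sum_congr rfl fun p _ => ?_
    have hq : (![(q : MvPolynomial (Fin 2) ℚ), MvPolynomial.X 0, MvPolynomial.X 1] 0) =
        algebraMap ℚ (MvPolynomial (Fin 2) ℚ) (q : ℚ) := by simp
    rw [hq, aeval_algebraMap_apply, coe_aeval_eq_eval, binomialPoly_eval_natCast]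
    simp
  have hD : D.bPolynomial = B := D.exists_isBPolynomial.choose_spec.unique h
  rw [hD]
  simp [hB, map_sum, ← Polynomial.aeval_algHom_apply]

theorem MultiDigraph.isAcyclic_of_strict {V A : Type*} (D : MultiDigraph V A) {q : ℕ}
    (f : V → Fin q) (h : ∀ u v, D.HasArc u v → f u < f v) : D.IsAcyclic := by
  intro v hv
  have : ∀ u, Relation.TransGen D.HasArc v u → f v < f u := fun u hu => by
    induction hu with
    | single h' => exact h _ _ h'
    | tail _ h' ih => exact ih.trans (h _ _ h')
  exact lt_irrefl _ (this v hv)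

/-! ### Edge and arc expansions for a fixed coloring. -/

namespace MixedGraph

variable {V A : Type*} [Fintype A] [DecidableEq A] (D : MixedGraph V A)

/-- The arcs of the edges in `S`, as a relation on the vertices. -/
def arcRel (S : Finset (Finset A)) (u v : V) : Prop :=
  ∃ e ∈ S, ∃ a ∈ e, D.origin a = u ∧ D.target a = v

/-- The edges none of whose arcs is an ascent of `f`. -/
def nonAscentEdges {q : ℕ} (f : V → Fin q) : Finset (Finset A) :=
  D.edges.parts.filter fun e => ∀ a ∈ e, f (D.target a) ≤ f (D.origin a)

/-- Of two opposite arcs, exactly one ascends when the end colors differ and none when they agree;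
so each edge counts once, on one side or the other. -/
theorem card_nonAscentEdges_add_numAscents {q : ℕ} (f : V → Fin q) :
    (D.nonAscentEdges f).card + D.numAscents f = D.numEdges := by
  have h1 : D.numAscents f = ∑ e ∈ D.edges.parts, ∑ a ∈ e,
      if f (D.origin a) < f (D.target a) then 1 else 0 := by
    rw [MultiDigraph.numAscents, Finset.card_filter,
      ← Finset.sum_congr D.edges.biUnion_parts fun _ _ => rfl, Finset.sum_biUnion D.edges.disjoint]
    rfl
  rw [h1, nonAscentEdges, Finset.card_filter, ← Finset.sum_add_distrib, numEdges,
    Finset.card_eq_sum_ones]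
  refine Finset.sum_congr rfl fun e he => ?_
  obtain ⟨a, rfl⟩ | ⟨a, b, hab, ⟨h₁, h₂⟩, rfl⟩ := D.edges_spec e he
  · by_cases h : f (D.origin a) < f (D.target a)
    · simp [h, h.not_ge, Finset.sum_singleton, -Finset.sum_boole]
    · simp [h, not_lt.1 h, -Finset.sum_boole]
  · rw [Finset.sum_pair hab]
    simp only [Finset.mem_insert, Finset.mem_singleton, forall_eq_or_imp, forall_eq, h₁, h₂]
    rcases lt_trichotomy (f (D.target b)) (f (D.origin b)) with h | h | h
    · simp [h, h.not_ge, h.not_gt]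
    · simp [h]
    · simp [h, h.not_ge, h.not_gt]

theorem subset_nonAscentEdges_iff {q : ℕ} (f : V → Fin q) {S : Finset (Finset A)}
    (hS : S ⊆ D.edges.parts) :
    S ⊆ D.nonAscentEdges f ↔ ∀ u v, D.arcRel S u v → f v ≤ f u := by
  constructor
  · rintro h _ _ ⟨e, he, a, ha, rfl, rfl⟩
    exact (Finset.mem_filter.1 (h he)).2 a ha
  · intro h e he
    exact Finset.mem_filter.2 ⟨hS he, fun a ha => h _ _ ⟨e, he, a, ha, rfl, rfl⟩⟩

theorem sum_powerset_ite_weak {R : Type*} [CommRing R] {q : ℕ} (f : V → Fin q)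
    (w : Finset (Finset A) → R)
    [∀ S, Decidable (∀ u v, D.arcRel S u v → f v ≤ f u)] :
    ∑ S ∈ D.edges.parts.powerset, (if ∀ u v, D.arcRel S u v → f v ≤ f u then w S else 0) =
      ∑ S ∈ (D.nonAscentEdges f).powerset, w S := by
  rw [← Finset.sum_filter]
  refine Finset.sum_congr ?_ fun _ _ => rfl
  ext S
  simp only [Finset.mem_filter, Finset.mem_powerset]
  constructor
  · rintro ⟨hS, h⟩
    exact (D.subset_nonAscentEdges_iff f hS).2 h
  · intro h
    have hS := h.trans (Finset.filter_subset _ _)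
    exact ⟨hS, (D.subset_nonAscentEdges_iff f hS).1 h⟩

theorem sum_powerset_sub_one_pow {R : Type*} [CommRing R] {q : ℕ} (f : V → Fin q) (y : R) :
    ∑ S ∈ (D.nonAscentEdges f).powerset, (y - 1) ^ S.card =
      y ^ (D.nonAscentEdges f).card := by
  have h := Finset.sum_pow_mul_eq_add_pow (y - 1) 1 (D.nonAscentEdges f)
  simpa using h

/-- This expands `y = -1 + (y + 1)` on the edges without ascent; `sum_powerset_ascents` expands `y +
1` on the ascending arcs instead. Their common value is the bridge between edge sets and arc sets.
-/
theorem sum_powerset_neg_one_pow_mul {R : Type*} [CommRing R] {q : ℕ} (f : V → Fin q) (y : R) :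
    ∑ S ∈ (D.nonAscentEdges f).powerset, (-1) ^ S.card * (y + 1) ^ (D.numEdges - S.card) =
      y ^ (D.nonAscentEdges f).card * (y + 1) ^ D.numAscents f := by
  have h := Finset.sum_pow_mul_eq_add_pow (-1) (y + 1) (D.nonAscentEdges f)
  rw [neg_add_cancel_comm_assoc] at h
  rw [← h, Finset.sum_mul]
  refine Finset.sum_congr rfl fun S hS => ?_
  have hc := Finset.card_le_card (Finset.mem_powerset.1 hS)
  have := D.card_nonAscentEdges_add_numAscents f
  rw [mul_assoc, ← pow_add]
  congr 2
  omega

theorem sum_powerset_ascents {R : Type*} [CommRing R] {q : ℕ} (f : V → Fin q) (y : R) :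
    ∑ S ∈ (Finset.univ.filter fun a => f (D.origin a) < f (D.target a)).powerset,
        y ^ (D.numEdges - S.card) =
      y ^ (D.nonAscentEdges f).card * (y + 1) ^ D.numAscents f := by
  have h := Finset.sum_pow_mul_eq_add_pow 1 y
    (Finset.univ.filter fun a => f (D.origin a) < f (D.target a))
  rw [MultiDigraph.numAscents, add_comm y, ← h, Finset.mul_sum]
  refine Finset.sum_congr rfl fun S hS => ?_
  have hc := Finset.card_le_card (Finset.mem_powerset.1 hS)
  have := D.card_nonAscentEdges_add_numAscents f
  rw [MultiDigraph.numAscents] at this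
  rw [one_pow, one_mul, ← pow_add]
  congr 1
  omega

theorem hasArc_delete_iff (S : Finset A) (u v : V) :
    (D.delete S).HasArc u v ↔ ∃ a ∈ Sᶜ, D.origin a = u ∧ D.target a = v := by
  simp only [MultiDigraph.HasArc, MultiDigraph.delete, Subtype.exists, Finset.mem_compl,
    exists_prop]

theorem strict_delete_iff (S : Finset A) {q : ℕ} (f : V → Fin q) :
    (∀ u v, (D.delete S).HasArc u v → f u < f v) ↔
      Sᶜ ⊆ Finset.univ.filter fun a => f (D.origin a) < f (D.target a) := by
  simp only [hasArc_delete_iff]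
  constructor
  · exact fun h a ha => Finset.mem_filter.2 ⟨Finset.mem_univ _, h _ _ ⟨a, ha, rfl, rfl⟩⟩
  · rintro h _ _ ⟨a, ha, rfl, rfl⟩
    exact (Finset.mem_filter.1 (h ha)).2

/-! ### Polynomiality and the expansion of `B`. -/

variable [Fintype V]

theorem exists_X_pow_dvd_weakOrderPoly {S : Finset (Finset A)} (hS : S ⊆ D.edges.parts) :
    ∃ k, Fintype.card V ≤ S.card + k ∧ D.numComponents ≤ k ∧
      X ^ k ∣ weakOrderPoly (D.arcRel S) := by
  classical
  refine ⟨_, ?_, ?_, X_pow_card_connectedComponent_dvd_weakOrderPoly _⟩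
  -- One arc per edge suffices: both arcs of an unoriented edge join the same vertices.
  · have hne : ∀ e : S, ∃ a, a ∈ e.1 := fun e => D.edges.nonempty_of_mem_parts (hS e.2)
    choose a ha using hne
    have h := SimpleGraph.card_vert_le_card_add_card_connectedComponent
      (SimpleGraph.fromRel (D.arcRel S)) (fun e => D.origin (a e)) (fun e => D.target (a e)) ?_
    · simpa using h
    have hr : ∀ u v, D.arcRel S u v → ∃ e, D.origin (a e) = u ∧ D.target (a e) = v ∨
        D.origin (a e) = v ∧ D.target (a e) = u := by
      rintro _ _ ⟨e, he, b, hb, rfl, rfl⟩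
      refine ⟨⟨e, he⟩, ?_⟩
      have hae := ha ⟨e, he⟩
      obtain ⟨c, rfl⟩ | ⟨c, d, -, ⟨h₁, h₂⟩, rfl⟩ := D.edges_spec e (hS he)
      · simp only [Finset.mem_singleton] at hae hb
        simp [hae, hb]
      · simp only [Finset.mem_insert, Finset.mem_singleton] at hae hb
        rcases hae with h | h <;> rcases hb with rfl | rfl <;> simp [h, h₁, h₂]
    intro u v huv
    rw [SimpleGraph.fromRel_adj] at huv
    rcases huv.2 with h | h
    · exact hr u v h
    · obtain ⟨e, he⟩ := hr v u h
      exact ⟨e, he.symm⟩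
  · refine SimpleGraph.ConnectedComponent.card_le_card_of_le ?_
    have hr : ∀ u v, D.arcRel S u v → D.HasArc u v := by
      rintro u v ⟨e, -, a, -, h⟩
      exact ⟨a, h⟩
    intro u v
    rw [SimpleGraph.fromRel_adj, SimpleGraph.fromRel_adj]
    exact fun h => ⟨h.1, h.2.imp (hr _ _) (hr _ _)⟩

theorem exists_mul_eq_sum_weakOrderPoly : ∃ T : MvPolynomial (Fin 2) ℚ,
    T * ((MvPolynomial.X 1 - 1) ^ Fintype.card V * (MvPolynomial.X 0 - 1) ^ D.numComponents) =
      ∑ S ∈ D.edges.parts.powerset, (MvPolynomial.X 1 - 1) ^ S.card *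
        aeval ((MvPolynomial.X 0 - 1) * (MvPolynomial.X 1 - 1))
          (weakOrderPoly (D.arcRel S)) := by
  have h : ∀ S : D.edges.parts.powerset, ∃ T : MvPolynomial (Fin 2) ℚ,
      T * ((MvPolynomial.X 1 - 1) ^ Fintype.card V * (MvPolynomial.X 0 - 1) ^ D.numComponents) =
        (MvPolynomial.X 1 - 1) ^ S.1.card *
          aeval ((MvPolynomial.X 0 - 1) * (MvPolynomial.X 1 - 1))
            (weakOrderPoly (D.arcRel S)) := fun S => by
    obtain ⟨k, h₁, h₂, M, hM⟩ := D.exists_X_pow_dvd_weakOrderPoly (Finset.mem_powerset.1 S.2)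
    obtain ⟨i, hi⟩ := Nat.exists_eq_add_of_le h₁
    obtain ⟨j, hj⟩ := Nat.exists_eq_add_of_le h₂
    -- The surplus exponents: `i = |S| + k - |V|` and `j = k - c(D)`.
    refine ⟨(MvPolynomial.X 1 - 1) ^ i * (MvPolynomial.X 0 - 1) ^ j *
      aeval ((MvPolynomial.X 0 - 1) * (MvPolynomial.X 1 - 1)) M, ?_⟩
    rw [hM, map_mul, map_pow, aeval_X, mul_pow]
    generalize aeval
      ((MvPolynomial.X 0 - 1) * (MvPolynomial.X 1 - 1) : MvPolynomial (Fin 2) ℚ) M = m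
    generalize (MvPolynomial.X 0 - 1 : MvPolynomial (Fin 2) ℚ) = x
    generalize (MvPolynomial.X 1 - 1 : MvPolynomial (Fin 2) ℚ) = y
    calc y ^ i * x ^ j * m * (y ^ Fintype.card V * x ^ D.numComponents)
        = y ^ (Fintype.card V + i) * x ^ (D.numComponents + j) * m := by ring
      _ = y ^ S.1.card * (x ^ k * y ^ k * m) := by rw [← hi, ← hj]; ring
  choose T hT using h
  refine ⟨∑ S, T S, ?_⟩
  rw [← Finset.sum_coe_sort D.edges.parts.powerset, Finset.sum_mul]
  exact Finset.sum_congr rfl fun S _ => hT S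

open scoped Classical in
theorem aeval_weakOrderPoly {R : Type*} [CommRing R] [Algebra ℚ R] (q : R) (r : V → V → Prop) :
    aeval q (weakOrderPoly r) = ∑ p ∈ Finset.range (Fintype.card V + 1),
      aeval q (binomialPoly p) * ∑ g : V → Fin p with Function.Surjective g,
        if ∀ u v, r u v → g v ≤ g u then 1 else 0 := by
  rw [weakOrderPoly, map_sum]
  refine Finset.sum_congr rfl fun p _ => ?_
  rw [map_mul, map_sum]
  congr 1
  refine Finset.sum_congr (by congr) fun g _ => ?_
  split_ifs <;> simp

open scoped Classical in
theorem sum_powerset_mul_aeval_weakOrderPoly {R : Type*} [CommRing R] [Algebra ℚ R] (q : R)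
    (w : Finset (Finset A) → R) :
    ∑ S ∈ D.edges.parts.powerset, w S * aeval q (weakOrderPoly (D.arcRel S)) =
      ∑ p ∈ Finset.range (Fintype.card V + 1), aeval q (binomialPoly p) *
        ∑ g : V → Fin p with Function.Surjective g,
          ∑ S ∈ (D.nonAscentEdges g).powerset, w S := by
  simp only [← sum_powerset_ite_weak, aeval_weakOrderPoly, Finset.mul_sum]
  rw [Finset.sum_comm]
  refine Finset.sum_congr rfl fun p _ => ?_
  rw [Finset.sum_comm]
  refine Finset.sum_congr (by congr) fun g _ => Finset.sum_congr rfl fun S _ => ?_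
  split_ifs <;> simp [mul_comm]

theorem pow_numEdges_mul_aeval_bPolynomial {F : Type*} [Field F] [Algebra ℚ F] (q y : F)
    (hy : y ≠ 0) :
    y ^ D.numEdges * MvPolynomial.aeval ![q, 1 / y, 1] D.bPolynomial =
      ∑ S ∈ D.edges.parts.powerset,
        (y - 1) ^ S.card * aeval q (weakOrderPoly (D.arcRel S)) := by
  classical
  rw [sum_powerset_mul_aeval_weakOrderPoly, MultiDigraph.aeval_bPolynomial, Finset.mul_sum]
  refine Finset.sum_congr rfl fun p _ => ?_
  rw [mul_left_comm, Finset.mul_sum]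
  congr 1
  refine Finset.sum_congr rfl fun g _ => ?_
  rw [sum_powerset_sub_one_pow, ← D.card_nonAscentEdges_add_numAscents g, one_pow, mul_one,
    pow_add, mul_assoc, ← mul_pow, mul_one_div_cancel hy, one_pow, mul_one]

/-! ### Reciprocity at `q = -1`. -/

/-- An acyclic set of arcs has at most one arc in every edge. -/
theorem card_compl_le_numEdges {S : Finset A} (hS : (D.delete S).IsAcyclic) :
    Sᶜ.card ≤ D.numEdges := by
  classical
  -- The alternating sum is nonzero, so some strict surjection `g` exists. All arcs outside `S` are
  -- ascents of `g`, and there are at most `|E|` ascents.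
  have h := sum_neg_one_pow_mul_numStrictSurjections _ hS _ (Nat.lt_succ_self _)
  obtain ⟨p, -, hp⟩ := Finset.exists_ne_zero_of_sum_ne_zero
    (h.trans_ne (pow_ne_zero _ (by norm_num)))
  have hp' : numStrictSurjections (D.delete S).HasArc p ≠ 0 := fun h0 => hp (by simp [h0])
  obtain ⟨g, hg⟩ := Finset.card_pos.1 (Nat.pos_of_ne_zero hp')
  have hle := Finset.card_le_card
    ((D.strict_delete_iff S g).1 (Finset.mem_filter.1 hg).2.2)
  have := D.card_nonAscentEdges_add_numAscents g
  rw [MultiDigraph.numAscents] at this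
  omega

/-- The two expansions agree for every surjection; weighting those onto `Fin p` by `binomialPoly p`
at `-1`, which is `(-1) ^ p`, carries the identity over to order polynomials at `-1`. -/
theorem sum_acyclicDeletions_pow {R : Type*} [CommRing R] [Algebra ℚ R] (y : R) :
    ∑ S ∈ D.acyclicDeletions, y ^ (D.numEdges - Sᶜ.card) =
      (-1) ^ Fintype.card V * ∑ S ∈ D.edges.parts.powerset,
        ((-1) ^ S.card * (y + 1) ^ (D.numEdges - S.card)) *
          aeval (-1 : R) (weakOrderPoly (D.arcRel S)) := by
  classical
  have hneg : ∀ p, aeval (-1 : R) (binomialPoly p) = (-1) ^ p := fun p => by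
    have := aeval_algebraMap_apply R (-1 : ℚ) (binomialPoly p)
    rw [coe_aeval_eq_eval, binomialPoly_eval_neg_one] at this
    simpa using this
  have hstrict : ∀ S ∈ D.acyclicDeletions, ∑ p ∈ Finset.range (Fintype.card V + 1),
      (-1 : R) ^ p * (numStrictSurjections (D.delete S).HasArc p : R) =
        (-1) ^ Fintype.card V := by
    intro S hS
    have h := sum_neg_one_pow_mul_numStrictSurjections _ (Finset.mem_filter.1 hS).2 _
      (Nat.lt_succ_self (Fintype.card V))
    simpa using congrArg (Int.cast : ℤ → R) h
  have hpoint : ∀ (p : ℕ) (g : V → Fin p),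
      (∑ S ∈ D.acyclicDeletions, if ∀ u v, (D.delete S).HasArc u v → g u < g v then
        y ^ (D.numEdges - Sᶜ.card) else 0) =
      ∑ S ∈ (D.nonAscentEdges g).powerset,
        (-1) ^ S.card * (y + 1) ^ (D.numEdges - S.card) := by
    intro p g
    rw [sum_powerset_neg_one_pow_mul, ← sum_powerset_ascents, ← Finset.sum_filter]
    -- Complementation matches deleted with remaining arcs; if all remaining arcs are ascents of
    -- `g`, acyclicity is automatic.
    refine Finset.sum_nbij' (fun S => Sᶜ) (fun S => Sᶜ) ?_ ?_ ?_ ?_ ?_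
    · intro S hS
      exact Finset.mem_powerset.2 ((D.strict_delete_iff S g).1 (Finset.mem_filter.1 hS).2)
    · intro S hS
      have h : ∀ u v, (D.delete Sᶜ).HasArc u v → g u < g v := by
        rw [strict_delete_iff, compl_compl]
        exact Finset.mem_powerset.1 hS
      exact Finset.mem_filter.2 ⟨Finset.mem_filter.2
        ⟨Finset.mem_univ _, MultiDigraph.isAcyclic_of_strict _ g h⟩, h⟩
    · simp
    · simp
    · simp
  have hsq : ((-1 : R) ^ Fintype.card V) * (-1) ^ Fintype.card V = 1 := by
    rw [← mul_pow]; simp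
  rw [sum_powerset_mul_aeval_weakOrderPoly]
  simp only [← hpoint, hneg]
  have hcomm : ∀ p : ℕ, (∑ g : V → Fin p with Function.Surjective g,
      ∑ S ∈ D.acyclicDeletions, if ∀ u v, (D.delete S).HasArc u v → g u < g v then
        y ^ (D.numEdges - Sᶜ.card) else 0) =
      ∑ S ∈ D.acyclicDeletions, (numStrictSurjections (D.delete S).HasArc p : R) *
        y ^ (D.numEdges - Sᶜ.card) := by
    intro p
    rw [Finset.sum_comm]
    refine Finset.sum_congr rfl fun S _ => ?_
    rw [← Finset.sum_filter, Finset.filter_filter, Finset.sum_const, nsmul_eq_mul,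
      numStrictSurjections]
  simp only [hcomm, Finset.mul_sum]
  rw [← Finset.sum_comm]
  refine Finset.sum_congr rfl fun S hS => ?_
  have := hstrict S hS
  rw [← Finset.mul_sum]
  simp only [← mul_assoc]
  rw [← Finset.sum_mul, this, ← mul_assoc, hsq, one_mul]

end MixedGraph

/-! ### The main theorem. -/

theorem theorem7p6 {V A : Type*} [Fintype V] [Fintype A] [DecidableEq A] (D : MixedGraph V A) :
    ∃ T : MvPolynomial (Fin 2) ℚ,
      algebraMap (MvPolynomial (Fin 2) ℚ) (FractionRing (MvPolynomial (Fin 2) ℚ)) T =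
        D.tutteOne ∧
      ∀ (K : Type*) [Field K] [CharZero K] (y : K), y + 1 ≠ 0 →
        (y + 1) ^ ((D.numEdges : ℤ) + (D.numComponents : ℤ) - (Fintype.card V : ℤ)) *
            MvPolynomial.aeval ![y + 2, y / (y + 1)] T =
          ∑ S ∈ D.acyclicDeletions, y ^ ((D.numEdges : ℤ) - (Sᶜ.card : ℤ)) := by
  classical
  obtain ⟨T, hT⟩ := D.exists_mul_eq_sum_weakOrderPoly
  refine ⟨T, ?_, fun K _ _ y hy => ?_⟩
  · set φ := algebraMap (MvPolynomial (Fin 2) ℚ) (FractionRing (MvPolynomial (Fin 2) ℚ)) with hφ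
    have hinj : Function.Injective φ := IsFractionRing.injective _ _
    have hne : ∀ {P : MvPolynomial (Fin 2) ℚ} (x : Fin 2 → ℚ), MvPolynomial.eval x P ≠ 0 →
        φ P ≠ 0 := fun x hx h => hx (by
      rw [(map_eq_zero_iff φ hinj).1 h, map_zero])
    -- The denominators are nonzero polynomials because they do not vanish at the point `(2, 2)`.
    have h0 : φ (MvPolynomial.X 0) - 1 ≠ 0 := fun h =>
      hne (P := MvPolynomial.X 0 - 1) (fun _ => 2) (by norm_num)
        ((RingHom.map_sub φ _ _).trans (by rw [RingHom.map_one]; exact h))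
    have h1 : φ (MvPolynomial.X 1) - 1 ≠ 0 := fun h =>
      hne (P := MvPolynomial.X 1 - 1) (fun _ => 2) (by norm_num)
        ((RingHom.map_sub φ _ _).trans (by rw [RingHom.map_one]; exact h))
    have hy : φ (MvPolynomial.X 1) ≠ 0 := hne (fun _ => 2) (by norm_num)
    have h := congrArg (IsScalarTower.toAlgHom ℚ (MvPolynomial (Fin 2) ℚ)
      (FractionRing (MvPolynomial (Fin 2) ℚ))) hT
    simp only [map_sum, map_mul, map_pow, map_sub, map_one, ← Polynomial.aeval_algHom_apply,
      IsScalarTower.coe_toAlgHom', ← hφ] at h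
    rw [MixedGraph.tutteOne, div_mul_eq_mul_div,
      D.pow_numEdges_mul_aeval_bPolynomial _ _ hy, ← h,
      mul_div_cancel_right₀ _ (mul_ne_zero (pow_ne_zero _ h1) (pow_ne_zero _ h0))]
  -- Here `x - 1` becomes `y + 1` and `y - 1` becomes `-(y + 1)⁻¹`, with product `-1`.
  · have h := congrArg (MvPolynomial.aeval ![y + 2, y / (y + 1)]) hT
    have ht : y / (y + 1) - 1 = -(y + 1)⁻¹ := by field_simp; ring
    have hx : y + 2 - 1 = y + 1 := by ring
    simp only [map_sum, map_mul, map_pow, map_sub, map_one, ← Polynomial.aeval_algHom_apply,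
      MvPolynomial.aeval_X, Matrix.cons_val_zero, Matrix.cons_val_one, ht, hx, mul_neg,
      mul_inv_cancel₀ hy] at h
    -- No exponent is negative, so the case `y = 0` needs no separate treatment.
    have hr : ∑ S ∈ D.acyclicDeletions, y ^ ((D.numEdges : ℤ) - (Sᶜ.card : ℤ)) =
        ∑ S ∈ D.acyclicDeletions, y ^ (D.numEdges - Sᶜ.card) := by
      refine Finset.sum_congr rfl fun S hS => ?_
      rw [← Nat.cast_sub (D.card_compl_le_numEdges (Finset.mem_filter.1 hS).2), zpow_natCast]
    have hl : ∑ S ∈ D.edges.parts.powerset,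
        ((-1) ^ S.card * (y + 1) ^ (D.numEdges - S.card)) *
          aeval (-1 : K) (weakOrderPoly (D.arcRel S)) =
        (y + 1) ^ D.numEdges * ∑ S ∈ D.edges.parts.powerset,
          (-(y + 1)⁻¹) ^ S.card * aeval (-1 : K) (weakOrderPoly (D.arcRel S)) := by
      rw [Finset.mul_sum]
      refine Finset.sum_congr rfl fun S hS => ?_
      have hc : S.card ≤ D.numEdges := Finset.card_le_card (Finset.mem_powerset.1 hS)
      rw [neg_pow (y + 1)⁻¹, inv_pow, pow_sub₀ _ hy hc]
      ring
    rw [hr, D.sum_acyclicDeletions_pow, hl, ← h, zpow_sub₀ hy, zpow_add₀ hy, neg_pow (y + 1)⁻¹,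
      inv_pow]
    simp only [zpow_natCast]
    have hsq : ((-1 : K) ^ Fintype.card V) * (-1) ^ Fintype.card V = 1 := by
      rw [← mul_pow]; simp
    field_simp
    linear_combination (-(MvPolynomial.aeval ![y + 2, y / (y + 1)] T)) * hsq
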